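/- Let $\mathcal M$ be a Markov decision process with state space $\mathcal S$, action space $\mathcal A$ (measurable spaces) and Markov transition kernel $\mathbf P(\cdot\mid s,a)$. Let a latent space model of $\mathcal M$ be given: a latent Markov decision process with latent state space $\bar{\mathcal S}$, a complete separable metric space with metric $d_{\bar{\mathcal S}}$ and its Borel $\sigma$-algebra, latent action space $\bar{\mathcal A}$ and transition kernel $\bar{\mathbf P}(\cdot\mid\bar s,\bar a)$; a measurable state embedding $\phi\colon\mathcal S\to\bar{\mathcal S}$; and a measurable action embedding $\psi\colon\bar{\mathcal S}\times\bar{\mathcal A}\to\mathcal A$. Let $\phi^{\mathcal A}(\cdot\mid\bar s,a)$ be a Markov kernel from $\bar{\mathcal S}\times\mathcal A$ to $\bar{\mathcal A}$ (the action encoder), and write $\bar s,\bar a\sim\phi(\cdot\mid s,a)$ for $\bar s=\phi(s)$ and $\bar a\sim\phi^{\mathcal A}(\cdot\mid\phi(s),a)$. Let $\pi$ be a memoryless policy and $\xi_\pi$ a stationary distribution of the Markov chain that $\pi$ induces in $\mathcal M$. Write $s,a\sim\xi_\pi$ for $s\sim\xi_\pi$, $a\sim\pi(\cdot\mid s)$,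 and $s,a,s'\sim\xi_\pi$ if moreover $s'\sim\mathbf P(\cdot\mid s,a)$. The local transition loss is $$L_{\mathbf P}(\xi_\pi)=\mathbb E_{s,a\sim\xi_\pi}\,\mathbb E_{\bar a\sim\phi^{\mathcal A}(\cdot\mid\phi(s),a)}\;W_{d_{\bar{\mathcal S}}}\bigl(\phi\mathbf P(\cdot\mid s,a),\,\bar{\mathbf P}(\cdot\mid\phi(s),\bar a)\bigr)\in[0,\infty],$$ where $\phi\mathbf P(\cdot\mid s,a)$ is the law of $\phi(s')$ for $s'\sim\mathbf P(\cdot\mid s,a)$ and $W_d(P,Q)=\inf_\lambda\mathbb E_{(x,y)\sim\lambda}\,d(x,y)$, the infimum being over all couplings $\lambda$ of $P$ and $Q$. Let $\mathcal X=\mathcal S\times\mathcal A\times\bar{\mathcal S}\times\bar{\mathcal A}$ and let $\mathcal F_{d_{\bar{\mathcal S}}}$ be the set of functions $\bar{\mathcal S}\to\mathbb R$ that are 1-Lipschitz for $d_{\bar{\mathcal S}}$. Then $$L_{\mathbf P}(\xi_\pi)=\sup_{\varphi\colon\mathcal X\to\mathcal F_{d_{\bar{\mathcal S}}}}\ \mathbb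 E_{s,a,s'\sim\xi_\pi}\,\mathbb E_{\bar s,\bar a\sim\phi(\cdot\mid s,a)}\Bigl[\varphi(s,a,\bar s,\bar a)\bigl(\phi(s')\bigr)-\mathbb E_{\bar s'\sim\bar{\mathbf P}(\cdot\mid\bar s,\bar a)}\,\varphi(s,a,\bar s,\bar a)(\bar s')\Bigr],$$ as an identity in $[0,\infty]$. The supremum is over all maps $\varphi$ for which these expectations exist: almost surely the function $\varphi(s,a,\bar s,\bar a)$ is integrable with respect to $\bar{\mathbf P}(\cdot\mid\bar s,\bar a)$, and the expression in brackets is integrable with respect to the joint law of $(s,a,s',\bar s,\bar a)$. -/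

import Mathlib

open MeasureTheory ProbabilityTheory
open scoped ENNReal

noncomputable section

/-- A Markov decision process with state space `S`, action space `A` and atomic propositions `AP`.
State and action spaces carry a sigma-algebra; `trans (s, a)` is the law of the next state. -/
structure MDP (S A AP : Type*) [MeasurableSpace S] [MeasurableSpace A] where
  trans : Kernel (S × A) S
  markov_trans : IsMarkovKernel trans
  reward : S × A → ℝ
  label : S → Set AP
  measurableSet_label : ∀ T : Set AP, MeasurableSet {s | label s = T}
  init : S

attribute [instance] MDP.markov_trans

/-- The transition kernel of the Markov chain induced by running the memoryless policy `π`: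
draw `a ∼ π(· ∣ s)`, then the next state from `P(· ∣ s, a)`. -/
def MDP.chain {S A AP : Type*} [MeasurableSpace S] [MeasurableSpace A]
    (M : MDP S A AP) (π : Kernel S A) : Kernel S S :=
  M.trans ∘ₖ (Kernel.id ×ₖ π)

/-- `ξ` is a stationary distribution of the chain induced by `π`. -/
def MDP.IsStationary {S A AP : Type*} [MeasurableSpace S] [MeasurableSpace A]
    (M : MDP S A AP) (π : Kernel S A) (ξ : Measure S) : Prop :=
  IsProbabilityMeasure ξ ∧ Kernel.Invariant (M.chain π) ξ

/-- `s, a ∼ ξ`: the state is drawn from `ξ`, then the action from `π(· ∣ s)`. -/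
def stateActionLaw {S A : Type*} [MeasurableSpace S] [MeasurableSpace A]
    (π : Kernel S A) (ξ : Measure S) : Measure (S × A) :=
  ξ ⊗ₘ π

/-- `s, a, s' ∼ ξ`: moreover the next state is drawn from `P(· ∣ s, a)`. -/
def MDP.transitionLaw {S A AP : Type*} [MeasurableSpace S] [MeasurableSpace A]
    (M : MDP S A AP) (π : Kernel S A) (ξ : Measure S) : Measure ((S × A) × S) :=
  stateActionLaw π ξ ⊗ₘ M.trans

/-- A latent space model of `M`: a latent MDP over the same atomic propositions, a state embedding
`φ : S → S'` and an action embedding `ψ : S' × A' → A`. -/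
structure LatentSpaceModel {S A AP : Type*} [MeasurableSpace S] [MeasurableSpace A]
    (M : MDP S A AP) (S' A' : Type*) [MeasurableSpace S'] [MeasurableSpace A'] where
  latent : MDP S' A' AP
  embedState : S → S'
  measurable_embedState : Measurable embedState
  embedAction : S' × A' → A
  measurable_embedAction : Measurable embedAction

/-- The couplings of `P` and `Q`. -/
def couplings {X : Type*} [MeasurableSpace X] (P Q : Measure X) : Set (Measure (X × X)) :=
  {γ | γ.map Prod.fst = P ∧ γ.map Prod.snd = Q}

/-- The Wasserstein distance: minimal expected distance over all couplings, in `[0, ∞]`. -/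
def wasserstein {X : Type*} [MeasurableSpace X] [MetricSpace X] (P Q : Measure X) : ℝ≥0∞ :=
  ⨅ γ ∈ couplings P Q, ∫⁻ z, edist z.1 z.2 ∂γ

/-- The 1-Lipschitz real functions on `X`. -/
abbrev Lip1 (X : Type*) [MetricSpace X] : Type _ := {f : X → ℝ // LipschitzWith 1 f}

namespace LatentSpaceModel

variable {S A S' A' AP : Type*} [MeasurableSpace S] [MeasurableSpace A]
  [MeasurableSpace S'] [MeasurableSpace A'] {M : MDP S A AP}

/-- The law of `φ(s')` for `s' ∼ P(· ∣ s, a)`. -/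
def embeddedTrans (L : LatentSpaceModel M S' A') (p : S × A) : Measure S' :=
  (M.trans p).map L.embedState

/-- The state-action encoder: given `(s, a)`, the latent state is `φ(s)` and the latent action is
drawn from the action encoder `enc` at `(φ(s), a)`. -/
def encoder (L : LatentSpaceModel M S' A') (enc : Kernel (S' × A) A') :
    Kernel (S × A) (S' × A') :=
  Kernel.deterministic (fun p : S × A => L.embedState p.1)
      (L.measurable_embedState.comp measurable_fst) ⊗ₖ
    enc.comap (fun q : (S × A) × S' => (q.2, q.1.2)) (by fun_prop)

/-- The local transition loss of `ξ`, for the parallel execution of `π` in both models: the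
expected Wasserstein distance between the embedded true transition and the latent transition. -/
def localTransitionLoss [MetricSpace S'] (L : LatentSpaceModel M S' A')
    (enc : Kernel (S' × A) A') (π : Kernel S A) (ξ : Measure S) : ℝ≥0∞ :=
  ∫⁻ p, ∫⁻ b, wasserstein (L.embeddedTrans p) (L.latent.trans (L.embedState p.1, b))
    ∂(enc (L.embedState p.1, p.2)) ∂(stateActionLaw π ξ)

/-- The sampled discrepancy of `f`, at `(s, a)`, next state `t` and latent pair `z = (s̄, ā)`:
`f(s, a, s̄, ā)(φ(t)) - E_{s̄' ∼ P̄(· ∣ s̄, ā)} f(s, a, s̄, ā)(s̄')`. -/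
def discrepancy [MetricSpace S'] (L : LatentSpaceModel M S' A')
    (f : S × A × S' × A' → Lip1 S') (p : S × A) (t : S) (z : S' × A') : ℝ :=
  (f (p.1, p.2, z.1, z.2)).1 (L.embedState t)
    - ∫ y, (f (p.1, p.2, z.1, z.2)).1 y ∂(L.latent.trans z)

/-- The quantity that is maximized: `E_{s, a, s'} E_{s̄, ā}` of the sampled discrepancy. -/
def objective [MetricSpace S'] (L : LatentSpaceModel M S' A')
    (enc : Kernel (S' × A) A') (π : Kernel S A) (ξ : Measure S)
    (f : S × A × S' × A' → Lip1 S') : ℝ :=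
  ∫ w, ∫ z, L.discrepancy f w.1 w.2 z ∂(L.encoder enc w.1) ∂(M.transitionLaw π ξ)

/-- The expectations in `objective` exist: almost surely the inner one (over `s̄'`), and the
outer one with respect to the joint law of `((s, a, s'), (s̄, ā))`. -/
def HasExpectations [MetricSpace S'] (L : LatentSpaceModel M S' A')
    (enc : Kernel (S' × A) A') (π : Kernel S A) (ξ : Measure S)
    (f : S × A × S' × A' → Lip1 S') : Prop :=
  (∀ᵐ w ∂(stateActionLaw π ξ ⊗ₘ L.encoder enc),
      Integrable (f (w.1.1, w.1.2, w.2.1, w.2.2)).1 (L.latent.trans w.2)) ∧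
    Integrable (fun w : ((S × A) × S) × (S' × A') => L.discrepancy f w.1.1 w.1.2 w.2)
      (M.transitionLaw π ξ ⊗ₘ (L.encoder enc).comap Prod.fst measurable_fst)

end LatentSpaceModel

end

/-! Exchanging the conditionally independent draws of `s'` and `ā` turns the objective into the
integral, over `(s, a, s̄, ā)`, of `∫ f d(φP) - ∫ f dP̄` with `f = φ(s, a, s̄, ā)`. It is at most
the integral of the Wasserstein distance, since a coupling bounds each such difference. For the
converse, a potential that is nearly optimal at every `(s, a, s̄, ā)` has to be chosen measurably.

This is why duality is proved with one sequence `g n` of bounded 1-Lipschitz functions serving all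
pairs of measures (`exists_wasserstein_eq_iSup`). The distance is then a countable supremum of
measurable functions, and taking the best of `g 0, ..., g N` at each point is a measurable selection
with finitely many values, hence admissible. Its gain is nonnegative because `g 0 = 0`, and
increases to the distance with `N`; monotone convergence gives the identity, infinite values
included.

The hard half of duality is discretized: points are rounded to a countable `ε`-net, at a cost of
order `ε`. On the net, `exists_discrete_coupling` obtains the coupling from the M. Riesz extension
theorem: the functional that a coupling must induce on sums `φ i + ψ j + a` is extended positively
to finitely supported functions of two variables. -/

/-! ### Discrete optimal transport by positive extension -/

/-- A termwise inequality between series with the same finite sum is an equality. -/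
lemma ENNReal.eq_of_le_of_tsum_le {ι : Type*} {a b : ι → ℝ≥0∞} (hab : ∀ i, a i ≤ b i)
    (hb : ∑' i, b i ≠ ∞) (h : ∑' i, b i ≤ ∑' i, a i) (i : ι) : a i = b i := by
  by_contra hne
  have ha : ∑' i, a i ≠ ∞ := ne_top_of_le_ne_top hb (ENNReal.tsum_le_tsum hab)
  exact absurd h (not_le.2 (ENNReal.tsum_lt_tsum ha hab (lt_of_le_of_ne (hab i) hne)))

/-- Two potentials, a constant and a function of two variables. -/
abbrev DualSpace : Type := (ℕ →₀ ℝ) × (ℕ →₀ ℝ) × ℝ × (ℕ × ℕ →₀ ℝ)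

/-- Existence of a coupling of two discrete laws whose cost is at most `D`, from the dual
condition on finitely supported potentials. -/
theorem exists_discrete_coupling {p q : ℕ → ℝ} {c : ℕ → ℕ → ℝ} {D : ℝ}
    (hp0 : ∀ i, 0 ≤ p i) (hq0 : ∀ i, 0 ≤ q i) (hp : HasSum p 1) (hq : HasSum q 1)
    (hc : ∀ i j, 0 ≤ c i j)
    (H : ∀ (φ ψ : ℕ →₀ ℝ) (a t : ℝ), 0 ≤ t → (∀ i j, 0 ≤ φ i + ψ j + a + t * c i j) →
      0 ≤ Finsupp.linearCombination ℝ p φ + Finsupp.linearCombination ℝ q ψ + a + t * D) :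
    ∃ γ : ℕ → ℕ → ℝ≥0∞, (∀ i, ∑' j, γ i j = ENNReal.ofReal (p i)) ∧
      (∀ j, ∑' i, γ i j = ENNReal.ofReal (q j)) ∧
      ∑' i, ∑' j, γ i j * ENNReal.ofReal (c i j) ≤ ENNReal.ofReal D := by
  -- A quadruple stands for the function `φ i + ψ j + a + h (i, j)`; it is in the cone if it becomes
  -- nonnegative after adding some `t * (c - D)` with `t ≥ 0`. The cost may be unbounded, so it
  -- enters through `t` and not as a vector. Positivity on this cone encodes both `γ ≥ 0` and cost
  -- at most `D`.
  let s : PointedCone ℝ DualSpace :=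
    { carrier := {v | ∃ t : ℝ, 0 ≤ t ∧
        ∀ i j, 0 ≤ v.1 i + v.2.1 j + (v.2.2.1 - t * D) + v.2.2.2 (i, j) + t * c i j}
      zero_mem' := ⟨0, le_rfl, fun i j => by simp⟩
      add_mem' := by
        rintro v w ⟨t, ht, h⟩ ⟨u, hu, k⟩
        refine ⟨t + u, add_nonneg ht hu, fun i j => ?_⟩
        have h1 := h i j
        have h2 := k i j
        simp only [Prod.fst_add, Prod.snd_add, Finsupp.add_apply]
        linarith
      smul_mem' := by
        rintro ⟨r, hr⟩ v ⟨t, ht, h⟩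
        refine ⟨r * t, mul_nonneg hr ht, fun i j => ?_⟩
        have h1 := mul_nonneg hr (h i j)
        have e : ∀ w : DualSpace, (⟨r, hr⟩ : {r : ℝ // 0 ≤ r}) • w = r • w := fun _ => rfl
        simp only [e, Prod.smul_fst, Prod.smul_snd, Finsupp.smul_apply, smul_eq_mul]
        linarith }
  have hs : ∀ (φ ψ : ℕ →₀ ℝ) (a : ℝ) (h : ℕ × ℕ →₀ ℝ), ((φ, ψ, a, h) : DualSpace) ∈ s ↔
      ∃ t : ℝ, 0 ≤ t ∧ ∀ i j, 0 ≤ φ i + ψ j + (a - t * D) + h (i, j) + t * c i j :=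
    fun _ _ _ _ => Iff.rfl
  let l : DualSpace →ₗ[ℝ] ℝ := (Finsupp.linearCombination ℝ p).coprod
    ((Finsupp.linearCombination ℝ q).coprod (LinearMap.id.coprod 0))
  have hl : ∀ (φ ψ : ℕ →₀ ℝ) (a : ℝ) (h : ℕ × ℕ →₀ ℝ), l (φ, ψ, a, h) =
      Finsupp.linearCombination ℝ p φ + (Finsupp.linearCombination ℝ q ψ + a) := by
    intro φ ψ a h
    simp [l]
  let V : Submodule ℝ DualSpace := LinearMap.ker
    ((LinearMap.snd ℝ ℝ (ℕ × ℕ →₀ ℝ)) ∘ₗ (LinearMap.snd ℝ (ℕ →₀ ℝ) _) ∘ₗ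
      (LinearMap.snd ℝ (ℕ →₀ ℝ) _))
  have hV : ∀ (φ ψ : ℕ →₀ ℝ) (a : ℝ), ((φ, ψ, a, 0) : DualSpace) ∈ V := fun φ ψ a => by simp [V]
  obtain ⟨g, hg, hgs⟩ := riesz_extension s ⟨V, l.domRestrict V⟩ (by
      rintro ⟨⟨φ, ψ, a, h⟩, hv⟩ ⟨t, ht, hm⟩
      obtain rfl : h = 0 := by simpa [V] using hv
      have h0 := H φ ψ (a - t * D) t ht (fun i j => by simpa using hm i j)
      change 0 ≤ l (φ, ψ, a, 0)
      rw [hl]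
      linarith) (by
      rintro ⟨φ, ψ, a, h⟩
      -- Cofinality: cancel the first three components, and dominate `h` by the constant `∑ |h x|`.
      refine ⟨⟨(-φ, -ψ, -a + ∑ x ∈ h.support, |h x|, 0), hV _ _ _⟩, 0, le_rfl, fun i j => ?_⟩
      have : -h (i, j) ≤ ∑ x ∈ h.support, |h x| := by
        by_cases hx : (i, j) ∈ h.support
        · exact (neg_le_abs _).trans
            (Finset.single_le_sum (f := fun x => |h x|) (fun x _ => abs_nonneg _) hx)
        · rw [Finsupp.notMem_support_iff.1 hx, neg_zero]
          exact Finset.sum_nonneg fun x _ => abs_nonneg _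
      simp only [Prod.mk_add_mk, Finsupp.add_apply, Finsupp.neg_apply, Finsupp.coe_zero,
        Pi.zero_apply]
      linarith)
  have hg' : ∀ (φ ψ : ℕ →₀ ℝ) (a : ℝ), g (φ, ψ, a, 0) =
      Finsupp.linearCombination ℝ p φ + (Finsupp.linearCombination ℝ q ψ + a) := by
    intro φ ψ a
    have := hg ⟨(φ, ψ, a, 0), hV φ ψ a⟩
    exact this.trans (hl φ ψ a 0)
  let w : (ℕ × ℕ →₀ ℝ) →ₗ[ℝ] ℝ := g ∘ₗ (LinearMap.inr ℝ (ℕ →₀ ℝ) _) ∘ₗ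
    (LinearMap.inr ℝ (ℕ →₀ ℝ) _) ∘ₗ (LinearMap.inr ℝ ℝ (ℕ × ℕ →₀ ℝ))
  have key : ∀ (φ ψ : ℕ →₀ ℝ) (a : ℝ) (h : ℕ × ℕ →₀ ℝ) (t : ℝ), 0 ≤ t →
      (∀ i j, 0 ≤ φ i + ψ j + (a - t * D) + h (i, j) + t * c i j) →
      0 ≤ Finsupp.linearCombination ℝ p φ + (Finsupp.linearCombination ℝ q ψ + a) + w h := by
    intro φ ψ a h t ht hm
    have h1 := hgs _ ((hs φ ψ a h).2 ⟨t, ht, hm⟩)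
    have h2 : ((φ, ψ, a, h) : DualSpace) = (φ, ψ, a, 0) + (0, 0, 0, h) := by simp
    rw [h2, map_add, hg'] at h1
    exact h1
  let G : ℕ × ℕ → ℝ := fun x => w (Finsupp.single x 1)
  have hG0 : ∀ x, 0 ≤ G x := by
    intro x
    have := key 0 0 0 (Finsupp.single x 1) 0 le_rfl (fun i j => by
      simp only [Finsupp.single_apply]; split_ifs <;> simp)
    simpa using this
  have hwsum : ∀ (F : Finset (ℕ × ℕ)) (r : ℕ × ℕ → ℝ),
      w (∑ x ∈ F, Finsupp.single x (r x)) = ∑ x ∈ F, G x * r x := by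
    intro F r
    rw [map_sum]
    refine Finset.sum_congr rfl fun x _ => ?_
    have : Finsupp.single x (r x) = r x • Finsupp.single x (1 : ℝ) := by simp
    rw [this, map_smul, smul_eq_mul, mul_comm]
  have happ : ∀ (F : Finset (ℕ × ℕ)) (r : ℕ × ℕ → ℝ) (y : ℕ × ℕ),
      (∑ x ∈ F, Finsupp.single x (r x)) y = if y ∈ F then r y else 0 := by
    intro F r y
    rw [Finsupp.finsetSum_apply]
    simp [Finsupp.single_apply]
  have happ1 : ∀ (F : Finset ℕ) (y : ℕ),
      (∑ x ∈ F, Finsupp.single x (1 : ℝ)) y = if y ∈ F then 1 else 0 := by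
    intro F y
    rw [Finsupp.finsetSum_apply]
    simp [Finsupp.single_apply]
  have hcost : ∀ F : Finset (ℕ × ℕ), ∑ x ∈ F, G x * c x.1 x.2 ≤ D := by
    intro F
    -- With `t = 1` the constant `D` cancels `-t * D`, leaving `c` minus its restriction to `F`.
    have := key 0 0 D (∑ x ∈ F, Finsupp.single x (-c x.1 x.2)) 1 zero_le_one (fun i j => by
      rw [happ]
      have := hc i j
      split_ifs <;> simp <;> linarith)
    rw [hwsum] at this
    simp only [map_zero, mul_neg, Finset.sum_neg_distrib] at this
    linarith
  have hrow : ∀ (i : ℕ) (F : Finset ℕ), ∑ j ∈ F, G (i, j) ≤ p i := by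
    intro i F
    have := key (Finsupp.single i 1) 0 0
      (∑ x ∈ F.map ⟨fun j => (i, j), Prod.mk_right_injective i⟩, Finsupp.single x (-1)) 0 le_rfl
      (fun i' j => by
        rw [happ]
        by_cases h : i = i'
        · subst h; simp; split_ifs <;> simp
        · simp [h])
    rw [hwsum] at this
    simp at this
    linarith
  have hcol : ∀ (j : ℕ) (F : Finset ℕ), ∑ i ∈ F, G (i, j) ≤ q j := by
    intro j F
    have := key 0 (Finsupp.single j 1) 0
      (∑ x ∈ F.map ⟨fun i => (i, j), Prod.mk_left_injective j⟩, Finsupp.single x (-1)) 0 le_rfl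
      (fun i j' => by
        rw [happ]
        by_cases h : j = j'
        · subst h; simp; split_ifs <;> simp
        · simp [h])
    rw [hwsum] at this
    simp at this
    linarith
  -- From `1_F(i) + 1_F(j) - 1 ≤ 1_{F × F}(i, j)`: no mass escapes to infinity. The total is thus at
  -- least 1, which forces equality in the row and column bounds.
  have hmass : ∀ F : Finset ℕ, ∑ i ∈ F, p i + ∑ j ∈ F, q j - 1 ≤ ∑ x ∈ F ×ˢ F, G x := by
    intro F
    have := key (-∑ x ∈ F, Finsupp.single x 1) (-∑ x ∈ F, Finsupp.single x 1) 1
      (∑ x ∈ F ×ˢ F, Finsupp.single x 1) 0 le_rfl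
      (fun i j => by
        rw [happ, Finsupp.neg_apply, Finsupp.neg_apply, happ1, happ1]
        by_cases hi : i ∈ F <;> by_cases hj : j ∈ F <;> simp [hi, hj])
    rw [hwsum] at this
    simp at this
    linarith
  have hpt : ∑' i, ENNReal.ofReal (p i) = 1 := by
    rw [← ENNReal.ofReal_tsum_of_nonneg hp0 hp.summable, hp.tsum_eq, ENNReal.ofReal_one]
  have hqt : ∑' i, ENNReal.ofReal (q i) = 1 := by
    rw [← ENNReal.ofReal_tsum_of_nonneg hq0 hq.summable, hq.tsum_eq, ENNReal.ofReal_one]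
  have hrow' : ∀ i, ∑' j, ENNReal.ofReal (G (i, j)) ≤ ENNReal.ofReal (p i) := by
    intro i
    rw [ENNReal.tsum_eq_iSup_sum]
    refine iSup_le fun F => ?_
    rw [← ENNReal.ofReal_sum_of_nonneg fun j _ => hG0 _]
    exact ENNReal.ofReal_le_ofReal (hrow i F)
  have hcol' : ∀ j, ∑' i, ENNReal.ofReal (G (i, j)) ≤ ENNReal.ofReal (q j) := by
    intro j
    rw [ENNReal.tsum_eq_iSup_sum]
    refine iSup_le fun F => ?_
    rw [← ENNReal.ofReal_sum_of_nonneg fun i _ => hG0 _]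
    exact ENNReal.ofReal_le_ofReal (hcol j F)
  have htot : 1 ≤ ∑' x, ENNReal.ofReal (G x) := by
    have hlim : Filter.Tendsto
        (fun F : Finset ℕ => ENNReal.ofReal (∑ i ∈ F, p i + ∑ j ∈ F, q j - 1)) Filter.atTop
        (nhds 1) := by
      have h1 : Filter.Tendsto (fun F : Finset ℕ => ∑ i ∈ F, p i + ∑ j ∈ F, q j - 1)
        Filter.atTop (nhds (1 + 1 - 1)) :=
        (Filter.Tendsto.add hp hq).sub_const 1
      have h2 := ENNReal.tendsto_ofReal h1
      simpa using h2
    refine le_of_tendsto' hlim fun F => ?_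
    refine (ENNReal.ofReal_le_ofReal (hmass F)).trans ?_
    rw [ENNReal.ofReal_sum_of_nonneg fun x _ => hG0 _]
    exact ENNReal.sum_le_tsum _
  refine ⟨fun i j => ENNReal.ofReal (G (i, j)), ?_, ?_, ?_⟩
  · refine ENNReal.eq_of_le_of_tsum_le hrow' (by simp [hpt]) ?_
    rwa [hpt, ← ENNReal.tsum_prod]
  · refine ENNReal.eq_of_le_of_tsum_le hcol' (by simp [hqt]) ?_
    rwa [hqt, ENNReal.tsum_comm, ← ENNReal.tsum_prod]
  · rw [← ENNReal.tsum_prod (f := fun i j => ENNReal.ofReal (G (i, j)) * ENNReal.ofReal (c i j)),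
      ENNReal.tsum_eq_iSup_sum]
    refine iSup_le fun F => ?_
    have : ∀ x ∈ F, ENNReal.ofReal (G (x.1, x.2)) * ENNReal.ofReal (c x.1 x.2) =
        ENNReal.ofReal (G x * c x.1 x.2) := fun x _ => (ENNReal.ofReal_mul (hG0 x)).symm
    rw [Finset.sum_congr rfl this, ← ENNReal.ofReal_sum_of_nonneg
      fun x _ => mul_nonneg (hG0 x) (hc _ _)]
    exact ENNReal.ofReal_le_ofReal (hcost F)

/-! ### Hard half of Kantorovich-Rubinstein duality, by discretization -/

/-- The `1`-Lipschitz envelope `x ↦ min K (inf_j (d(x, x_j) + r_j))`. -/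
lemma exists_bounded_lipschitz_between {X : Type*} [MetricSpace X] (x : ℕ → X) (r : ℕ → ℝ) {b K : ℝ} (hb : ∀ j, b ≤ r j) :
    ∃ f : X → ℝ, LipschitzWith 1 f ∧ (∃ C, ∀ y, |f y| ≤ C) ∧ (∀ j, f (x j) ≤ r j) ∧
      ∀ y s, s ≤ K → (∀ j, s ≤ dist y (x j) + r j) → s ≤ f y := by
  have hbdd : ∀ y, BddBelow (Set.range fun j => dist y (x j) + r j) := fun y =>
    ⟨b, by rintro _ ⟨j, rfl⟩; exact (hb j).trans (le_add_of_nonneg_left dist_nonneg)⟩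
  have hle : ∀ y j, ⨅ j, (dist y (x j) + r j) ≤ dist y (x j) + r j := fun y j => ciInf_le (hbdd y) j
  refine ⟨fun y => min K (⨅ j, (dist y (x j) + r j)), ?_, ⟨max |K| |min K b|, fun y => ?_⟩,
    fun j => ?_, fun y s hs h => le_min hs (le_ciInf h)⟩
  · refine LipschitzWith.const_min (LipschitzWith.of_le_add fun y z => ?_) K
    rw [← sub_le_iff_le_add]
    refine le_ciInf fun j => ?_
    have := hle y j
    have := dist_triangle y z (x j)
    linarith
  · rw [abs_le]
    have h1 : min K b ≤ min K (⨅ j, (dist y (x j) + r j)) :=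
      min_le_min le_rfl (le_ciInf fun j => (hb j).trans (le_add_of_nonneg_left dist_nonneg))
    have h2 : min K (⨅ j, (dist y (x j) + r j)) ≤ K := min_le_left _ _
    exact ⟨(neg_le.1 ((neg_le_abs _).trans (le_max_right _ _))).trans h1,
      h2.trans ((le_abs_self _).trans (le_max_left _ _))⟩
  · refine (min_le_right _ _).trans ((hle _ j).trans ?_)
    simp

section Duality

variable {X : Type*} [MeasurableSpace X]

lemma tsum_measure_fiber_inter (P : Measure X) {i : X → ℕ} (hi : Measurable i) {B : Set X}
    (hB : MeasurableSet B) : ∑' n, P (B ∩ i ⁻¹' {n}) = P B := by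
  rw [← measure_iUnion _ fun n => hB.inter (hi (measurableSet_singleton n)), ← Set.inter_iUnion]
  · congr 1
    ext x
    simp
  · intro m n hmn
    refine Disjoint.mono Set.inter_subset_right Set.inter_subset_right ?_
    exact Disjoint.preimage i (by simpa using hmn)

lemma hasSum_measureReal_fiber (P : Measure X) [IsProbabilityMeasure P] {i : X → ℕ}
    (hi : Measurable i) : HasSum (fun n => P.real (i ⁻¹' {n})) 1 := by
  have h := tsum_measure_fiber_inter P hi MeasurableSet.univ
  simp only [Set.univ_inter, measure_univ] at h
  have h1 := ENNReal.hasSum_toReal (f := fun n => P (i ⁻¹' {n})) (by simp [h])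
  rwa [← ENNReal.tsum_toReal_eq (fun n => measure_ne_top _ _), h, ENNReal.toReal_one] at h1

lemma integrable_finsupp_comp (P : Measure X) [IsFiniteMeasure P] {i : X → ℕ}
    (hi : Measurable i) (φ : ℕ →₀ ℝ) : Integrable (fun x => φ (i x)) P := by
  refine Integrable.of_bound ((measurable_of_countable φ).comp hi).aestronglyMeasurable
    (∑ n ∈ φ.support, |φ n|) (Filter.Eventually.of_forall fun x => ?_)
  rw [Real.norm_eq_abs]
  by_cases hx : i x ∈ φ.support
  · exact Finset.single_le_sum (f := fun n => |φ n|) (fun n _ => abs_nonneg _) hx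
  · rw [Finsupp.notMem_support_iff.1 hx, abs_zero]
    exact Finset.sum_nonneg fun n _ => abs_nonneg _

lemma integral_finsupp_comp (P : Measure X) [IsFiniteMeasure P] {i : X → ℕ}
    (hi : Measurable i) (φ : ℕ →₀ ℝ) :
    ∫ x, φ (i x) ∂P = Finsupp.linearCombination ℝ (fun n => P.real (i ⁻¹' {n})) φ := by
  induction φ using Finsupp.induction_linear with
  | zero => simp
  | add f g hf hg =>
    simp only [Finsupp.add_apply, map_add]
    rw [integral_add (integrable_finsupp_comp P hi f) (integrable_finsupp_comp P hi g), hf, hg]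
  | single n b =>
    have : (fun x => (Finsupp.single n b) (i x)) = (i ⁻¹' {n}).indicator fun _ => b := by
      ext x
      by_cases hx : i x = n <;> simp [hx]
    rw [this, integral_indicator_const b (hi (measurableSet_singleton n))]
    simp [mul_comm]

/-- A coupling of the laws of an index function lifts to a coupling of the measures. -/
lemma exists_coupling_of_fiber_coupling (P Q : Measure X) [IsFiniteMeasure P] [IsFiniteMeasure Q]
    {i : X → ℕ} (hi : Measurable i) {γ : ℕ → ℕ → ℝ≥0∞}
    (h1 : ∀ m, ∑' n, γ m n = P (i ⁻¹' {m})) (h2 : ∀ n, ∑' m, γ m n = Q (i ⁻¹' {n})) :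
    ∃ Γ ∈ couplings P Q, ∀ g : ℕ → ℕ → ℝ≥0∞,
      ∫⁻ z, g (i z.1) (i z.2) ∂Γ ≤ ∑' m, ∑' n, γ m n * g m n := by
  have hiS : ∀ n, MeasurableSet (i ⁻¹' {n}) := fun n => hi (measurableSet_singleton n)
  have hle1 : ∀ m n, γ m n ≤ P (i ⁻¹' {m}) := fun m n => (h1 m) ▸ ENNReal.le_tsum n
  have hle2 : ∀ m n, γ m n ≤ Q (i ⁻¹' {n}) := fun m n =>
    (h2 n) ▸ ENNReal.le_tsum (f := fun m => γ m n) m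
  -- Inside the cell `(m, n)` the mass `γ m n` is spread as the normalized product of the
  -- restrictions. On null cells `γ m n = 0`, so the convention `0 / 0 = 0` is harmless.
  let w : ℕ → ℕ → ℝ≥0∞ := fun m n => γ m n / (P (i ⁻¹' {m}) * Q (i ⁻¹' {n}))
  have hw : ∀ m n, w m n * (P (i ⁻¹' {m}) * Q (i ⁻¹' {n})) = γ m n := by
    intro m n
    refine ENNReal.div_mul_cancel' (fun h => ?_) fun h => ?_
    · rcases mul_eq_zero.1 h with h | h
      · exact le_antisymm (h ▸ hle1 m n) bot_le
      · exact le_antisymm (h ▸ hle2 m n) bot_le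
    · exact absurd h (ENNReal.mul_ne_top (measure_ne_top _ _) (measure_ne_top _ _))
  let Γ : Measure (X × X) := Measure.sum fun k : ℕ × ℕ =>
    w k.1 k.2 • (P.restrict (i ⁻¹' {k.1})).prod (Q.restrict (i ⁻¹' {k.2}))
  refine ⟨Γ, ⟨?_, ?_⟩, fun g => ?_⟩
  · ext B hB
    rw [Measure.map_sum measurable_fst.aemeasurable, Measure.sum_apply _ hB]
    simp only [Measure.map_smul, Measure.map_fst_prod, Measure.smul_apply,
      Measure.restrict_apply hB, Measure.restrict_apply_univ, smul_eq_mul]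
    rw [ENNReal.tsum_prod' , ← tsum_measure_fiber_inter P hi hB]
    refine tsum_congr fun m => ?_
    by_cases h0 : P (i ⁻¹' {m}) = 0
    · simp [measure_mono_null (Set.inter_subset_right (s := B)) h0]
    have hr : P (B ∩ i ⁻¹' {m}) = (P (B ∩ i ⁻¹' {m}) / P (i ⁻¹' {m})) * P (i ⁻¹' {m}) :=
      (ENNReal.div_mul_cancel h0 (measure_ne_top _ _)).symm
    have : ∀ n, w m n * (Q (i ⁻¹' {n}) * P (B ∩ i ⁻¹' {m})) =
        γ m n * (P (B ∩ i ⁻¹' {m}) / P (i ⁻¹' {m})) := by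
      intro n
      rw [← hw m n]
      nth_rw 1 [hr]
      ring
    simp_rw [this]
    rw [ENNReal.tsum_mul_right, h1 m, mul_comm, ← hr]
  · ext B hB
    rw [Measure.map_sum measurable_snd.aemeasurable, Measure.sum_apply _ hB]
    simp only [Measure.map_smul, Measure.map_snd_prod, Measure.smul_apply,
      Measure.restrict_apply hB, Measure.restrict_apply_univ, smul_eq_mul]
    rw [ENNReal.tsum_prod', ENNReal.tsum_comm, ← tsum_measure_fiber_inter Q hi hB]
    refine tsum_congr fun n => ?_
    by_cases h0 : Q (i ⁻¹' {n}) = 0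
    · simp [measure_mono_null (Set.inter_subset_right (s := B)) h0]
    have hr : Q (B ∩ i ⁻¹' {n}) = (Q (B ∩ i ⁻¹' {n}) / Q (i ⁻¹' {n})) * Q (i ⁻¹' {n}) :=
      (ENNReal.div_mul_cancel h0 (measure_ne_top _ _)).symm
    have : ∀ m, w m n * (P (i ⁻¹' {m}) * Q (B ∩ i ⁻¹' {n})) =
        γ m n * (Q (B ∩ i ⁻¹' {n}) / Q (i ⁻¹' {n})) := by
      intro m
      rw [← hw m n]
      nth_rw 1 [hr]
      ring
    simp_rw [this]
    rw [ENNReal.tsum_mul_right, h2 n, mul_comm, ← hr]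
  · rw [lintegral_sum_measure, ENNReal.tsum_prod']
    refine ENNReal.tsum_le_tsum fun m => ENNReal.tsum_le_tsum fun n => ?_
    rw [lintegral_smul_measure, Measure.prod_restrict, smul_eq_mul]
    have : ∫⁻ z in (i ⁻¹' {m}) ×ˢ (i ⁻¹' {n}), g (i z.1) (i z.2) ∂(P.prod Q) =
        g m n * (P (i ⁻¹' {m}) * Q (i ⁻¹' {n})) := by
      rw [← Measure.prod_prod, ← setLIntegral_const]
      refine setLIntegral_congr_fun ((hiS m).prod (hiS n)) ?_
      rintro ⟨x, y⟩ ⟨hx, hy⟩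
      simp only [Set.mem_preimage, Set.mem_singleton_iff] at hx hy
      simp [hx, hy]
    rw [this, ← hw m n]
    exact le_of_eq (by ring)

variable [MetricSpace X] [BorelSpace X]

lemma integrable_of_bounded_lipschitz (P : Measure X) [IsFiniteMeasure P] {f : X → ℝ}
    (hf : LipschitzWith 1 f) (hb : ∃ C, ∀ y, |f y| ≤ C) : Integrable f P := by
  obtain ⟨C, hC⟩ := hb
  exact Integrable.of_bound hf.continuous.measurable.aestronglyMeasurable C
    (Filter.Eventually.of_forall hC)

/-- The dual condition for the discretized transport problem. -/
lemma discretized_dual_nonneg (P Q : Measure X) [IsProbabilityMeasure P] [IsProbabilityMeasure Q]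
    {D : ℝ} (hD : ∀ f : X → ℝ, LipschitzWith 1 f → (∃ C, ∀ y, |f y| ≤ C) →
      ∫ y, f y ∂P - ∫ y, f y ∂Q ≤ D)
    {ε : ℝ} {x : ℕ → X} {i : X → ℕ} (hi : Measurable i) (hix : ∀ y, dist y (x (i y)) ≤ ε)
    (φ ψ : ℕ →₀ ℝ) (a t : ℝ) (ht : 0 < t)
    (h : ∀ m n, 0 ≤ φ m + ψ n + a + t * dist (x m) (x n)) :
    0 ≤ ∫ y, φ (i y) ∂P + ∫ y, ψ (i y) ∂Q + a + t * (D + 2 * ε) := by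
  have hbound : ∀ (φ : ℕ →₀ ℝ) n, |φ n| ≤ ∑ m ∈ φ.support, |φ m| := by
    intro φ n
    by_cases hx : n ∈ φ.support
    · exact Finset.single_le_sum (f := fun m => |φ m|) (fun m _ => abs_nonneg _) hx
    · rw [Finsupp.notMem_support_iff.1 hx, abs_zero]
      exact Finset.sum_nonneg fun n _ => abs_nonneg _
  -- The envelope of `ψ / t` lies below `ψ / t` and above `(-φ - a) / t` on the net, by `h`. The cap
  -- `K` is above every `(-φ m - a) / t`, so it makes `f` bounded without spoiling the lower bound.
  obtain ⟨f, hf, hfb, hf1, hf2⟩ := exists_bounded_lipschitz_between x (fun n => ψ n / t)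
    (b := (-∑ m ∈ ψ.support, |ψ m|) / t) (K := (∑ m ∈ φ.support, |φ m| - a) / t) (fun n => by
      gcongr
      exact (abs_le.1 (hbound ψ n)).1)
  have hfP := integrable_of_bounded_lipschitz P hf hfb
  have hfQ := integrable_of_bounded_lipschitz Q hf hfb
  have hf2' : ∀ m, (-φ m - a) / t ≤ f (x m) := by
    refine fun m => hf2 _ _ ?_ fun n => ?_
    · gcongr
      linarith [(abs_le.1 (hbound φ m)).1]
    · rw [div_le_iff₀ ht, add_mul, div_mul_cancel₀ _ ht.ne']
      linarith [h m n]
  have hdist : ∀ y, |f y - f (x (i y))| ≤ ε := by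
    intro y
    have := hf.dist_le_mul y (x (i y))
    rw [Real.dist_eq, NNReal.coe_one, one_mul] at this
    exact this.trans (hix y)
  have e1 : ∫ y, -(φ (i y)) ∂P ≤ ∫ y, (t * f y + (t * ε + a)) ∂P := by
    refine integral_mono (integrable_finsupp_comp P hi φ).neg
      ((hfP.const_mul t).add (integrable_const _)) fun y => ?_
    have h1 := hf2' (i y)
    rw [div_le_iff₀ ht] at h1
    have h2 := mul_le_mul_of_nonneg_left (abs_le.1 (hdist y)).1 ht.le
    simp only
    linarith
  have e2 : ∫ y, (t * f y - t * ε) ∂Q ≤ ∫ y, ψ (i y) ∂Q := by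
    refine integral_mono ((hfQ.const_mul t).sub (integrable_const _))
      (integrable_finsupp_comp Q hi ψ) fun y => ?_
    have h1 := hf1 (i y)
    rw [le_div_iff₀ ht] at h1
    have h2 := mul_le_mul_of_nonneg_left (abs_le.1 (hdist y)).2 ht.le
    simp only
    linarith
  rw [integral_neg, integral_add (hfP.const_mul t) (integrable_const _), integral_const_mul,
    integral_const, probReal_univ, one_smul] at e1
  rw [integral_sub (hfQ.const_mul t) (integrable_const _), integral_const_mul,
    integral_const, probReal_univ, one_smul] at e2
  have e3 := mul_le_mul_of_nonneg_left (hD f hf hfb) ht.le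
  linarith

/-- Rounding to the first point of a dense sequence within `ε` is measurable. -/
lemma exists_measurable_index [SecondCountableTopology X] [Nonempty X] {ε : ℝ} (hε : 0 < ε) :
    ∃ (x : ℕ → X) (i : X → ℕ), Measurable i ∧ ∀ y, dist y (x (i y)) ≤ ε := by
  classical
  have hex : ∀ y, ∃ n, dist y (TopologicalSpace.denseSeq X n) < ε := fun y => by
    obtain ⟨z, hz, n, rfl⟩ := Metric.dense_iff.1 (TopologicalSpace.denseRange_denseSeq X) y ε hε
    exact ⟨n, by rwa [dist_comm]⟩
  refine ⟨TopologicalSpace.denseSeq X, fun y => Nat.find (hex y), measurable_find hex fun n => ?_,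
    fun y => (Nat.find_spec (hex y)).le⟩
  exact measurableSet_lt (by fun_prop) measurable_const

/-- Kantorovich-Rubinstein duality: the nontrivial inequality. -/
theorem wasserstein_le_of_forall_bounded_lipschitz [SecondCountableTopology X]
    (P Q : Measure X) [IsProbabilityMeasure P] [IsProbabilityMeasure Q]
    {D : ℝ} (hD : ∀ f : X → ℝ, LipschitzWith 1 f → (∃ C, ∀ y, |f y| ≤ C) →
      ∫ y, f y ∂P - ∫ y, f y ∂Q ≤ D) : wasserstein P Q ≤ ENNReal.ofReal D := by
  have hX : Nonempty X := P.nonempty_of_neZero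
  have hD0 : 0 ≤ D := by
    simpa using hD (fun _ => 0) (LipschitzWith.const' 0) ⟨0, by simp⟩
  have main : ∀ ε : ℝ, 0 < ε → wasserstein P Q ≤ ENNReal.ofReal (D + 4 * ε) := by
    intro ε hε
    obtain ⟨x, i, hi, hix⟩ := exists_measurable_index (X := X) hε
    obtain ⟨γ, hγ1, hγ2, hγ⟩ := exists_discrete_coupling
      (p := fun n => P.real (i ⁻¹' {n})) (q := fun n => Q.real (i ⁻¹' {n}))
      -- The extra `2 * ε` makes the cost dominate the distance between any two points rounded to `x
      -- m` and `x n`; rounding in the dual condition costs another `2 * ε`.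
      (c := fun m n => dist (x m) (x n) + 2 * ε) (D := D + 4 * ε)
      (fun _ => measureReal_nonneg) (fun _ => measureReal_nonneg)
      (hasSum_measureReal_fiber P hi) (hasSum_measureReal_fiber Q hi)
      (fun _ _ => by positivity) (by
        intro φ ψ a t ht h
        rw [← integral_finsupp_comp P hi, ← integral_finsupp_comp Q hi]
        -- `discretized_dual_nonneg` divides by its multiplier, and `t` may be 0. Since the cost is
        -- nonnegative, any `u > t` keeps the hypothesis; then `u` tends to `t`.
        have pos : ∀ u : ℝ, t < u →
            0 ≤ ∫ y, φ (i y) ∂P + ∫ y, ψ (i y) ∂Q + a + u * (D + 4 * ε) := by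
          intro u hu
          have := discretized_dual_nonneg P Q hD hi hix φ ψ (a + u * (2 * ε)) u (ht.trans_lt hu)
            (fun m n => by
              have h1 := h m n
              have h2 : t * (dist (x m) (x n) + 2 * ε) ≤ u * (dist (x m) (x n) + 2 * ε) :=
                mul_le_mul_of_nonneg_right hu.le (by positivity)
              linarith)
          linarith
        have hlim : Filter.Tendsto
            (fun u : ℝ => ∫ y, φ (i y) ∂P + ∫ y, ψ (i y) ∂Q + a + u * (D + 4 * ε))
            (nhdsWithin t (Set.Ioi t))
            (nhds (∫ y, φ (i y) ∂P + ∫ y, ψ (i y) ∂Q + a + t * (D + 4 * ε))) :=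
          Filter.Tendsto.mono_left (Continuous.tendsto (by fun_prop) t) nhdsWithin_le_nhds
        exact ge_of_tendsto hlim (Filter.eventually_of_mem self_mem_nhdsWithin pos))
    obtain ⟨Γ, hΓ, hΓg⟩ := exists_coupling_of_fiber_coupling P Q hi (γ := γ)
      (fun m => by rw [hγ1, ofReal_measureReal]) (fun n => by rw [hγ2, ofReal_measureReal])
    refine (iInf₂_le Γ hΓ).trans (le_trans ?_
      ((hΓg fun m n => ENNReal.ofReal (dist (x m) (x n) + 2 * ε)).trans hγ))
    refine lintegral_mono fun z => ?_
    rw [edist_dist]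
    refine ENNReal.ofReal_le_ofReal ?_
    have h1 := dist_triangle4 z.1 (x (i z.1)) (x (i z.2)) z.2
    have h2 := hix z.1
    have h3 := hix z.2
    rw [dist_comm] at h3
    linarith
  have hlim : Filter.Tendsto (fun ε : ℝ => ENNReal.ofReal (D + 4 * ε))
      (nhdsWithin 0 (Set.Ioi 0)) (nhds (ENNReal.ofReal (D + 4 * 0))) :=
    ENNReal.tendsto_ofReal
      (Filter.Tendsto.mono_left (Continuous.tendsto (by fun_prop) 0) nhdsWithin_le_nhds)
  rw [mul_zero, add_zero] at hlim
  exact ge_of_tendsto hlim (Filter.eventually_of_mem self_mem_nhdsWithin main)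

end Duality

/-! ### Easy half of duality, and a universal sequence of test functions -/

/-- Without integrability the Bochner integral is 0, so the bound by the positive part needs no
hypothesis. -/
lemma ofReal_integral_le_lintegral {Ω : Type*} [MeasurableSpace Ω] (μ : Measure Ω) (f : Ω → ℝ) :
    ENNReal.ofReal (∫ x, f x ∂μ) ≤ ∫⁻ x, ENNReal.ofReal (f x) ∂μ := by
  by_cases hf : Integrable f μ
  · rw [integral_eq_lintegral_pos_part_sub_lintegral_neg_part hf]
    refine (ENNReal.ofReal_le_ofReal (sub_le_self _ ENNReal.toReal_nonneg)).trans ?_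
    exact ENNReal.ofReal_toReal_le
  · simp [integral_undef hf]

/-- Kantorovich-Rubinstein duality: the easy inequality. -/
theorem ofReal_integral_sub_le_wasserstein {X : Type*} [MeasurableSpace X] [MetricSpace X]
    [BorelSpace X] {P Q : Measure X} {f : X → ℝ} (hf : LipschitzWith 1 f)
    (hP : Integrable f P) (hQ : Integrable f Q) :
    ENNReal.ofReal (∫ y, f y ∂P - ∫ y, f y ∂Q) ≤ wasserstein P Q := by
  refine le_iInf₂ fun γ hγ => ?_
  obtain ⟨h1, h2⟩ := hγ
  have m := hf.continuous.measurable
  have e1 : Integrable (fun z : X × X => f z.1) γ :=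
    Integrable.comp_measurable (h1.symm ▸ hP) measurable_fst
  have e2 : Integrable (fun z : X × X => f z.2) γ :=
    Integrable.comp_measurable (h2.symm ▸ hQ) measurable_snd
  rw [← h1, ← h2, integral_map measurable_fst.aemeasurable m.aestronglyMeasurable,
    integral_map measurable_snd.aemeasurable m.aestronglyMeasurable, ← integral_sub e1 e2]
  refine (ofReal_integral_le_lintegral _ _).trans ?_
  refine lintegral_mono fun z => ?_
  rw [edist_dist]
  have := hf.dist_le_mul z.1 z.2
  rw [Real.dist_eq, NNReal.coe_one, one_mul] at this
  exact ENNReal.ofReal_le_ofReal ((le_abs_self _).trans this)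

/-- The bounded `1`-Lipschitz functions contain a sequence which is dense for bounded pointwise
convergence. -/
lemma exists_dense_bounded_lipschitz (X : Type*) [MetricSpace X] [SecondCountableTopology X]
    [Nonempty X] :
    ∃ g : ℕ → X → ℝ, g 0 = 0 ∧ (∀ n, LipschitzWith 1 (g n)) ∧ (∀ n, ∃ C, ∀ y, |g n y| ≤ C) ∧
      ∀ f : X → ℝ, LipschitzWith 1 f → (∃ C, ∀ y, |f y| ≤ C) →
        ∃ (C : ℝ) (k : ℕ → ℕ), (∀ n y, |g (k n) y| ≤ C) ∧
          ∀ y, Filter.Tendsto (fun n => g (k n) y) Filter.atTop (nhds (f y)) := by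
  let x := TopologicalSpace.denseSeq X
  -- Restriction to a dense sequence embeds the functions bounded by `K` in the second countable
  -- space `ℕ → ℝ`, so the set of restrictions is separable.
  let S : ℕ → Set (ℕ → ℝ) := fun K =>
    {u | ∃ f : X → ℝ, LipschitzWith 1 f ∧ (∀ y, |f y| ≤ (K : ℝ)) ∧ ∀ k, f (x k) = u k}
  have hne : ∀ K, Nonempty (S K) := fun K =>
    ⟨⟨fun _ => 0, fun _ => 0, LipschitzWith.const' 0, by simp, fun _ => rfl⟩⟩
  have hmem : ∀ (K n : ℕ), ∃ f : X → ℝ, LipschitzWith 1 f ∧ (∀ y, |f y| ≤ (K : ℝ)) ∧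
      ∀ k, f (x k) = (TopologicalSpace.denseSeq (S K) n : ℕ → ℝ) k :=
    fun K n => (TopologicalSpace.denseSeq (S K) n).2
  choose G hG1 hG2 hG3 using hmem
  -- Index 0 is kept for the zero function; `n + 1` codes the pair of a bound and a position.
  refine ⟨fun n => n.casesOn 0 fun n => G n.unpair.1 n.unpair.2, rfl, fun n => ?_, fun n => ?_, ?_⟩
  · cases n with
    | zero => exact LipschitzWith.const' 0
    | succ n => exact hG1 _ _
  · cases n with
    | zero => exact ⟨0, by simp⟩
    | succ n => exact ⟨_, hG2 _ _⟩
  rintro f hf ⟨C, hC⟩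
  obtain ⟨K, hK⟩ := exists_nat_ge C
  let u : S K := ⟨fun k => f (x k), f, hf, fun y => (hC y).trans hK, fun _ => rfl⟩
  have hu : u ∈ closure (Set.range (TopologicalSpace.denseSeq (S K))) :=
    TopologicalSpace.denseRange_denseSeq (S K) u
  obtain ⟨v, hv, hvu⟩ := mem_closure_iff_seq_limit.1 hu
  choose k hk using hv
  refine ⟨K, fun n => Nat.pair K (k n) + 1, fun n y => ?_, fun y => ?_⟩
  · simpa using hG2 K (k n) y
  · simp only [Nat.unpair_pair]
    have hpt : ∀ j, Filter.Tendsto (fun n => G K (k n) (x j)) Filter.atTop (nhds (f (x j))) := by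
      intro j
      have := ((continuous_apply j).comp continuous_subtype_val).continuousAt.tendsto.comp hvu
      refine this.congr fun n => ?_
      simp only [Function.comp_apply]
      rw [hG3, hk]
    -- The common Lipschitz constant carries convergence from the dense sequence to every point.
    rw [Metric.tendsto_atTop]
    intro ε hε
    obtain ⟨z, hz, j, rfl⟩ := Metric.dense_iff.1 (TopologicalSpace.denseRange_denseSeq X) y
      (ε / 3) (by positivity)
    obtain ⟨N, hN⟩ := Metric.tendsto_atTop.1 (hpt j) (ε / 3) (by positivity)
    refine ⟨N, fun n hn => ?_⟩
    have h1 := (hG1 K (k n)).dist_le_mul y (x j)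
    have h2 := hf.dist_le_mul (x j) y
    have h3 := dist_triangle4 (G K (k n) y) (G K (k n) (x j)) (f (x j)) (f y)
    have h4 := hN n hn
    have h5 : dist (x j) y < ε / 3 := hz
    rw [NNReal.coe_one, one_mul] at h1 h2
    rw [dist_comm y] at h1
    linarith

/-- Kantorovich-Rubinstein duality, with a countable family of test functions that does not depend
on the measures. -/
theorem exists_wasserstein_eq_iSup (X : Type*) [MetricSpace X] [SecondCountableTopology X]
    [MeasurableSpace X] [BorelSpace X] [Nonempty X] :
    ∃ g : ℕ → X → ℝ, g 0 = 0 ∧ (∀ n, LipschitzWith 1 (g n)) ∧ (∀ n, ∃ C, ∀ y, |g n y| ≤ C) ∧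
      ∀ (P Q : Measure X) [IsProbabilityMeasure P] [IsProbabilityMeasure Q],
        wasserstein P Q = ⨆ n, ENNReal.ofReal (∫ y, g n y ∂P - ∫ y, g n y ∂Q) := by
  obtain ⟨g, hg0, hg1, hg2, hg3⟩ := exists_dense_bounded_lipschitz X
  refine ⟨g, hg0, hg1, hg2, fun P Q _ _ => le_antisymm ?_ (iSup_le fun n => ?_)⟩
  · by_cases htop : ⨆ n, ENNReal.ofReal (∫ y, g n y ∂P - ∫ y, g n y ∂Q) = ∞
    · rw [htop]; exact le_top
    rw [← ENNReal.ofReal_toReal htop]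
    refine wasserstein_le_of_forall_bounded_lipschitz P Q fun f hf hfb => ?_
    obtain ⟨C, k, hC, hk⟩ := hg3 f hf hfb
    have hlim : ∀ (μ : Measure X) [IsProbabilityMeasure μ], Filter.Tendsto
        (fun n => ∫ y, g (k n) y ∂μ) Filter.atTop (nhds (∫ y, f y ∂μ)) := by
      intro μ _
      exact tendsto_integral_of_dominated_convergence (fun _ => C)
        (fun n => (hg1 _).continuous.measurable.aestronglyMeasurable) (integrable_const C)
        (fun n => Filter.Eventually.of_forall (hC n)) (Filter.Eventually.of_forall hk)
    refine le_of_tendsto' ((hlim P).sub (hlim Q)) fun n => ?_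
    exact (ENNReal.ofReal_le_iff_le_toReal htop).1
      (le_iSup (fun n => ENNReal.ofReal (∫ y, g n y ∂P - ∫ y, g n y ∂Q)) (k n))
  · exact ofReal_integral_sub_le_wasserstein (hg1 n)
      (integrable_of_bounded_lipschitz P (hg1 n) (hg2 n))
      (integrable_of_bounded_lipschitz Q (hg1 n) (hg2 n))

/-! ### Exchange of draws and measurable selection -/

/-- Two conditionally independent draws can be exchanged. -/
lemma MeasureTheory.Measure.compProd_comap_fst_swap {α β γ : Type*} [MeasurableSpace α]
    [MeasurableSpace β] [MeasurableSpace γ] (μ : Measure α) [SFinite μ] (κ : Kernel α β)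
    [IsSFiniteKernel κ] (η : Kernel α γ) [IsSFiniteKernel η] :
    ((μ ⊗ₘ κ) ⊗ₘ η.comap Prod.fst measurable_fst).map
        (fun w : (α × β) × γ => ((w.1.1, w.2), w.1.2)) =
      (μ ⊗ₘ η) ⊗ₘ κ.comap Prod.fst measurable_fst := by
  refine Measure.ext_of_lintegral _ fun f hf => ?_
  rw [lintegral_map hf (by fun_prop), Measure.lintegral_compProd (by fun_prop),
    Measure.lintegral_compProd (by fun_prop), Measure.lintegral_compProd hf,
    Measure.lintegral_compProd (by fun_prop)]
  refine lintegral_congr fun a => ?_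
  simp only [Kernel.comap_apply]
  exact lintegral_lintegral_swap (f := fun b c => f ((a, c), b)) (by fun_prop)

/-- Taking the least maximizing index makes the choice measurable. -/
lemma exists_measurable_argmax {Ω : Type*} [MeasurableSpace Ω] {d : ℕ → Ω → ℝ}
    (hd : ∀ n, Measurable (d n)) (N : ℕ) :
    ∃ i : Ω → ℕ, Measurable i ∧ (∀ w, i w ≤ N) ∧ ∀ w, ∀ m ≤ N, d m w ≤ d (i w) w := by
  classical
  have hex : ∀ w, ∃ n, n ≤ N ∧ ∀ m ≤ N, d m w ≤ d n w := fun w => by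
    obtain ⟨n, hn, h⟩ := Finset.exists_max_image (Finset.range (N + 1)) (fun n => d n w) ⟨0, by simp⟩
    exact ⟨n, by simpa [Nat.lt_succ_iff] using hn, fun m hm => h m (by simpa [Nat.lt_succ_iff])⟩
  refine ⟨fun w => Nat.find (hex w), measurable_find hex fun n => ?_,
    fun w => (Nat.find_spec (hex w)).1, fun w => (Nat.find_spec (hex w)).2⟩
  have : {w | n ≤ N ∧ ∀ m ≤ N, d m w ≤ d n w} =
      {_w : Ω | n ≤ N} ∩ ⋂ m, ⋂ (_ : m ≤ N), {w | d m w ≤ d n w} := by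
    ext w
    simp
  rw [this]
  exact (MeasurableSet.const _).inter
    (MeasurableSet.iInter fun m => MeasurableSet.iInter fun _ => measurableSet_le (hd m) (hd n))

/-! ### Loss and objective as integrals over `(s, a, s̄, ā)` -/

namespace LatentSpaceModel

variable {S A S' A' AP : Type*} [MeasurableSpace S] [MeasurableSpace A]
  [MeasurableSpace S'] [MeasurableSpace A'] {M : MDP S A AP}

instance (L : LatentSpaceModel M S' A') (p : S × A) : IsProbabilityMeasure (L.embeddedTrans p) :=
  Measure.isProbabilityMeasure_map L.measurable_embedState.aemeasurable

instance (L : LatentSpaceModel M S' A') (enc : Kernel (S' × A) A') [IsMarkovKernel enc] :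
    IsMarkovKernel (L.encoder enc) := by
  unfold encoder
  infer_instance

lemma lintegral_encoder (L : LatentSpaceModel M S' A') (enc : Kernel (S' × A) A')
    [IsMarkovKernel enc] {F : S' × A' → ℝ≥0∞} (hF : Measurable F) (p : S × A) :
    ∫⁻ z, F z ∂(L.encoder enc p) =
      ∫⁻ b, F (L.embedState p.1, b) ∂(enc (L.embedState p.1, p.2)) := by
  have hm : Measurable fun q : S' => ∫⁻ b, F (q, b) ∂(enc (q, p.2)) :=
    Measurable.lintegral_kernel_prod_right'
      (κ := enc.comap (fun q : S' => (q, p.2)) (by fun_prop)) hF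
  rw [encoder, Kernel.lintegral_compProd _ _ _ hF]
  simp only [Kernel.comap_apply]
  exact Kernel.lintegral_deterministic' _ hm

lemma measurable_integral_sub_integral (L : LatentSpaceModel M S' A') {g : S' → ℝ}
    (hg : Measurable g) : Measurable fun w : (S × A) × (S' × A') =>
      ∫ y, g y ∂(L.embeddedTrans w.1) - ∫ y, g y ∂(L.latent.trans w.2) := by
  have h1 : Measurable fun p : S × A => ∫ y, g y ∂(L.embeddedTrans p) := by
    have := (hg.stronglyMeasurable.integral_kernel
      (κ := M.trans.map L.embedState)).measurable
    simpa only [Kernel.map_apply _ L.measurable_embedState, embeddedTrans] using this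
  have h2 : Measurable fun z : S' × A' => ∫ y, g y ∂(L.latent.trans z) :=
    (hg.stronglyMeasurable.integral_kernel (κ := L.latent.trans)).measurable
  exact (h1.comp measurable_fst).sub (h2.comp measurable_snd)

variable [MetricSpace S']

/-- The mean of the discrepancy over the next state. -/
noncomputable def meanDiscrepancy (L : LatentSpaceModel M S' A') (f : S × A × S' × A' → Lip1 S')
    (w : (S × A) × (S' × A')) : ℝ :=
  ∫ y, (f (w.1.1, w.1.2, w.2.1, w.2.2)).1 y ∂(L.embeddedTrans w.1) -
    ∫ y, (f (w.1.1, w.1.2, w.2.1, w.2.2)).1 y ∂(L.latent.trans w.2)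

lemma localTransitionLoss_eq_lintegral (L : LatentSpaceModel M S' A') (enc : Kernel (S' × A) A')
    [IsMarkovKernel enc] (π : Kernel S A) [IsMarkovKernel π] (ξ : Measure S)
    [IsProbabilityMeasure ξ]
    (hW : Measurable fun w : (S × A) × (S' × A') =>
      wasserstein (L.embeddedTrans w.1) (L.latent.trans w.2)) :
    L.localTransitionLoss enc π ξ = ∫⁻ w, wasserstein (L.embeddedTrans w.1) (L.latent.trans w.2)
      ∂(stateActionLaw π ξ ⊗ₘ L.encoder enc) := by
  have : SFinite (stateActionLaw π ξ) := by unfold stateActionLaw; infer_instance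
  rw [Measure.lintegral_compProd hW]
  refine lintegral_congr fun p => ?_
  exact (L.lintegral_encoder enc (hW.comp measurable_prodMk_left) p).symm

variable [BorelSpace S']

/-- Fubini with `s'` integrated first. The map `f` need not be measurable: all that is used is the
joint integrability in `HasExpectations` and the continuity of each value of `f`. -/
lemma integrable_meanDiscrepancy_and_objective_eq (L : LatentSpaceModel M S' A')
    (enc : Kernel (S' × A) A') [IsMarkovKernel enc] (π : Kernel S A) [IsMarkovKernel π]
    (ξ : Measure S) [IsProbabilityMeasure ξ] {f : S × A × S' × A' → Lip1 S'}
    (hf : L.HasExpectations enc π ξ f) :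
    (∀ᵐ w ∂(stateActionLaw π ξ ⊗ₘ L.encoder enc),
      Integrable (f (w.1.1, w.1.2, w.2.1, w.2.2)).1 (L.embeddedTrans w.1) ∧
      Integrable (f (w.1.1, w.1.2, w.2.1, w.2.2)).1 (L.latent.trans w.2)) ∧
    Integrable (L.meanDiscrepancy f) (stateActionLaw π ξ ⊗ₘ L.encoder enc) ∧
    L.objective enc π ξ f = ∫ w, L.meanDiscrepancy f w ∂(stateActionLaw π ξ ⊗ₘ L.encoder enc) := by
  have h1 : IsProbabilityMeasure (stateActionLaw π ξ) := by unfold stateActionLaw; infer_instance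
  have h2 : IsProbabilityMeasure (M.transitionLaw π ξ) := by
    unfold MDP.transitionLaw; infer_instance
  obtain ⟨hf1, hf2⟩ := hf
  let e : ((S × A) × S) × (S' × A') ≃ᵐ ((S × A) × (S' × A')) × S :=
    { toFun := fun w => ((w.1.1, w.2), w.1.2)
      invFun := fun w => ((w.1.1, w.2), w.1.2)
      left_inv := fun _ => rfl
      right_inv := fun _ => rfl
      measurable_toFun := Measurable.prodMk (by fun_prop) (by fun_prop)
      measurable_invFun := Measurable.prodMk (by fun_prop) (by fun_prop) }
  have hswap : (M.transitionLaw π ξ ⊗ₘ (L.encoder enc).comap Prod.fst measurable_fst).map e =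
      (stateActionLaw π ξ ⊗ₘ L.encoder enc) ⊗ₘ M.trans.comap Prod.fst measurable_fst :=
    Measure.compProd_comap_fst_swap _ _ _
  let F : ((S × A) × (S' × A')) × S → ℝ := fun w => L.discrepancy f w.1.1 w.2 w.1.2
  have hF : Integrable F ((stateActionLaw π ξ ⊗ₘ L.encoder enc) ⊗ₘ
      M.trans.comap Prod.fst measurable_fst) := by
    rw [← hswap, integrable_map_equiv]
    exact hf2
  have hobj : L.objective enc π ξ f = ∫ w, F w ∂((stateActionLaw π ξ ⊗ₘ L.encoder enc) ⊗ₘ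
      M.trans.comap Prod.fst measurable_fst) := by
    rw [← hswap, integral_map_equiv]
    exact (Measure.integral_compProd hf2).symm
  have hFi := ((Measure.integrable_compProd_iff hF.aestronglyMeasurable).1 hF).1
  have hint : ∀ᵐ w ∂(stateActionLaw π ξ ⊗ₘ L.encoder enc),
      Integrable (f (w.1.1, w.1.2, w.2.1, w.2.2)).1 (L.embeddedTrans w.1) := by
    filter_upwards [hFi] with w hw
    have hm := (f (w.1.1, w.1.2, w.2.1, w.2.2)).2.continuous.measurable
    refine (integrable_map_measure hm.aestronglyMeasurable
      L.measurable_embedState.aemeasurable).2 ?_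
    -- For fixed `w` the subtracted term does not depend on `s'`; adding it back shows that the
    -- potential itself is integrable.
    have := hw.add (integrable_const
      (∫ y, (f (w.1.1, w.1.2, w.2.1, w.2.2)).1 y ∂(L.latent.trans w.2)))
    refine this.congr (Filter.Eventually.of_forall fun t => ?_)
    simp [F, discrepancy]
  have hmean : (fun w => ∫ t, F (w, t) ∂(M.trans w.1)) =ᵐ[stateActionLaw π ξ ⊗ₘ L.encoder enc]
      L.meanDiscrepancy f := by
    filter_upwards [hint] with w hw
    have hm := (f (w.1.1, w.1.2, w.2.1, w.2.2)).2.continuous.measurable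
    have hw' := (integrable_map_measure hm.aestronglyMeasurable
      L.measurable_embedState.aemeasurable).1 hw
    simp only [F, discrepancy, meanDiscrepancy]
    rw [embeddedTrans, integral_map L.measurable_embedState.aemeasurable hm.aestronglyMeasurable]
    refine (integral_sub hw' (integrable_const _)).trans ?_
    simp
  refine ⟨hint.and hf1, ?_, ?_⟩
  · exact (Integrable.integral_compProd hF).congr hmean
  · rw [hobj, Measure.integral_compProd hF]
    exact integral_congr_ae hmean

lemma objective_le_lintegral_wasserstein (L : LatentSpaceModel M S' A')
    (enc : Kernel (S' × A) A') [IsMarkovKernel enc] (π : Kernel S A) [IsMarkovKernel π]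
    (ξ : Measure S) [IsProbabilityMeasure ξ] {f : S × A × S' × A' → Lip1 S'}
    (hf : L.HasExpectations enc π ξ f) :
    ENNReal.ofReal (L.objective enc π ξ f) ≤
      ∫⁻ w, wasserstein (L.embeddedTrans w.1) (L.latent.trans w.2)
        ∂(stateActionLaw π ξ ⊗ₘ L.encoder enc) := by
  obtain ⟨h1, -, h3⟩ := L.integrable_meanDiscrepancy_and_objective_eq enc π ξ hf
  rw [h3]
  refine (ofReal_integral_le_lintegral _ _).trans (lintegral_mono_ae ?_)
  filter_upwards [h1] with w hw
  exact ofReal_integral_sub_le_wasserstein (f _).2 hw.1 hw.2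

/-- Measurable selection from a sequence of bounded test functions has expectations. -/
lemma hasExpectations_of_index (L : LatentSpaceModel M S' A') (enc : Kernel (S' × A) A')
    [IsMarkovKernel enc] (π : Kernel S A) [IsMarkovKernel π] (ξ : Measure S)
    [IsProbabilityMeasure ξ] {g : ℕ → S' → ℝ} (hg : ∀ n, LipschitzWith 1 (g n))
    (hb : ∀ n, ∃ C, ∀ y, |g n y| ≤ C) {i : (S × A) × (S' × A') → ℕ} (hi : Measurable i) {N : ℕ}
    (hN : ∀ w, i w ≤ N) :
    L.HasExpectations enc π ξ fun x => ⟨g (i ((x.1, x.2.1), (x.2.2.1, x.2.2.2))), hg _⟩ := by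
  have h1 : IsProbabilityMeasure (stateActionLaw π ξ) := by unfold stateActionLaw; infer_instance
  have h2 : IsProbabilityMeasure (M.transitionLaw π ξ) := by
    unfold MDP.transitionLaw; infer_instance
  choose C hC using hb
  let B := ∑ n ∈ Finset.range (N + 1), |C n|
  have hB : ∀ w y, |g (i w) y| ≤ B := fun w y => (hC (i w) y).trans <| (le_abs_self _).trans <|
    Finset.single_le_sum (f := fun n => |C n|) (fun n _ => abs_nonneg _)
      (Finset.mem_range.2 (Nat.lt_succ_of_le (hN w)))
  refine ⟨Filter.Eventually.of_forall fun w =>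
    integrable_of_bounded_lipschitz _ (hg _) ⟨B, hB _⟩, ?_⟩
  have m1 : Measurable fun x : ℕ × S' => g x.1 x.2 :=
    measurable_from_prod_countable_right fun n => (hg n).continuous.measurable
  have m2 : Measurable fun x : ℕ × (S' × A') => ∫ y, g x.1 y ∂(L.latent.trans x.2) :=
    measurable_from_prod_countable_right fun n =>
      ((hg n).continuous.measurable.stronglyMeasurable.integral_kernel
        (κ := L.latent.trans)).measurable
  have m3 : Measurable fun w : ((S × A) × S) × (S' × A') => i (w.1.1, w.2) :=
    hi.comp (by fun_prop)
  refine Integrable.of_bound (Measurable.aestronglyMeasurable ?_) (B + B)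
    (Filter.Eventually.of_forall fun w => ?_)
  · exact (m1.comp (m3.prodMk (L.measurable_embedState.comp (by fun_prop)))).sub
      (m2.comp (m3.prodMk measurable_snd))
  · refine (norm_sub_le _ _).trans (add_le_add (hB _ _) ?_)
    refine (norm_integral_le_of_norm_le_const
      (Filter.Eventually.of_forall fun y => hB (w.1.1, w.2) y)).trans ?_
    simp

end LatentSpaceModel

/-! ### The identity -/

theorem mainTheorem5 {S A S' A' AP : Type*}
    [MeasurableSpace S] [MeasurableSpace A] [MeasurableSpace A']
    [MetricSpace S'] [CompleteSpace S'] [SecondCountableTopology S']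
    [MeasurableSpace S'] [BorelSpace S']
    (M : MDP S A AP) (L : LatentSpaceModel M S' A')
    (enc : Kernel (S' × A) A') [IsMarkovKernel enc]
    (π : Kernel S A) [IsMarkovKernel π]
    (ξ : Measure S) (hξ : M.IsStationary π ξ) :
    ((L.localTransitionLoss enc π ξ : ℝ≥0∞) : EReal) =
      ⨆ (f : S × A × S' × A' → Lip1 S') (_ : L.HasExpectations enc π ξ f),
        ((L.objective enc π ξ f : ℝ) : EReal) := by
  have hprob : IsProbabilityMeasure ξ := hξ.1
  have hS : Nonempty S := ξ.nonempty_of_neZero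
  have hS' : Nonempty S' := hS.map L.embedState
  obtain ⟨g, hg0, hg, hgb, hgW⟩ := exists_wasserstein_eq_iSup S'
  let d : ℕ → (S × A) × (S' × A') → ℝ := fun n w =>
    ∫ y, g n y ∂(L.embeddedTrans w.1) - ∫ y, g n y ∂(L.latent.trans w.2)
  have hd : ∀ n, Measurable (d n) := fun n =>
    L.measurable_integral_sub_integral (hg n).continuous.measurable
  have hWd : ∀ w : (S × A) × (S' × A'), wasserstein (L.embeddedTrans w.1) (L.latent.trans w.2) =
      ⨆ n, ENNReal.ofReal (d n w) := fun w => hgW _ _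
  have hW : Measurable fun w : (S × A) × (S' × A') =>
      wasserstein (L.embeddedTrans w.1) (L.latent.trans w.2) := by
    simp_rw [hWd]
    exact Measurable.iSup fun n => (hd n).ennreal_ofReal
  rw [L.localTransitionLoss_eq_lintegral enc π ξ hW]
  refine le_antisymm ?_ (iSup₂_le fun f hf => ?_)
  · choose i hi hiN hmax using exists_measurable_argmax hd
    have hpos : ∀ N w, 0 ≤ d (i N w) w := fun N w => by
      simpa [d, hg0] using hmax N w 0 (Nat.zero_le _)
    have hmeas : ∀ N, Measurable fun w => d (i N w) w := fun N =>
      (measurable_from_prod_countable_right (f := fun x : ℕ × _ => d x.1 x.2) hd).comp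
        ((hi N).prodMk measurable_id)
    let f : ℕ → S × A × S' × A' → Lip1 S' := fun N x =>
      ⟨g (i N ((x.1, x.2.1), (x.2.2.1, x.2.2.2))), hg _⟩
    have hf : ∀ N, L.HasExpectations enc π ξ (f N) := fun N =>
      L.hasExpectations_of_index enc π ξ hg hgb (hi N) (hiN N)
    have hobj : ∀ N, ENNReal.ofReal (L.objective enc π ξ (f N)) =
        ∫⁻ w, ENNReal.ofReal (d (i N w) w) ∂(stateActionLaw π ξ ⊗ₘ L.encoder enc) := by
      intro N
      obtain ⟨-, h2, h3⟩ := L.integrable_meanDiscrepancy_and_objective_eq enc π ξ (hf N)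
      rw [h3]
      exact ofReal_integral_eq_lintegral_ofReal h2 (Filter.Eventually.of_forall (hpos N))
    have hsup : ∀ w : (S × A) × (S' × A'),
        wasserstein (L.embeddedTrans w.1) (L.latent.trans w.2) =
          ⨆ N, ENNReal.ofReal (d (i N w) w) := by
      intro w
      rw [hWd]
      refine le_antisymm (iSup_mono fun N => ENNReal.ofReal_le_ofReal (hmax N w N le_rfl))
        (iSup_le fun N => le_iSup (fun n => ENNReal.ofReal (d n w)) _)
    have hle : ∀ N, ((L.objective enc π ξ (f N) : ℝ) : EReal) ≤
        ⨆ (f : S × A × S' × A' → Lip1 S') (_ : L.HasExpectations enc π ξ f),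
          ((L.objective enc π ξ f : ℝ) : EReal) := fun N =>
      le_iSup₂ (f := fun f (_ : L.HasExpectations enc π ξ f) =>
        ((L.objective enc π ξ f : ℝ) : EReal)) (f N) (hf N)
    have hnonneg : ∀ N, 0 ≤ L.objective enc π ξ (f N) := by
      intro N
      obtain ⟨-, -, h3⟩ := L.integrable_meanDiscrepancy_and_objective_eq enc π ξ (hf N)
      rw [h3]
      exact integral_nonneg (hpos N)
    -- The supremum is at least the objective of `f 0`, hence nonnegative, so the comparison can
    -- move to `ℝ≥0∞`.
    rw [← EReal.coe_toENNReal ((EReal.coe_nonneg.2 (hnonneg 0)).trans (hle 0)),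
      EReal.coe_ennreal_le_coe_ennreal_iff]
    simp_rw [hsup]
    rw [lintegral_iSup (fun N => (hmeas N).ennreal_ofReal) (fun m n hmn w =>
      ENNReal.ofReal_le_ofReal (hmax n w _ ((hiN m w).trans hmn)))]
    refine iSup_le fun N => ?_
    rw [← hobj N]
    simpa using EReal.toENNReal_le_toENNReal (hle N)
  · refine le_trans ?_ (EReal.coe_ennreal_le_coe_ennreal_iff.2
      (L.objective_le_lintegral_wasserstein enc π ξ hf))
    rw [EReal.coe_ennreal_ofReal]
    exact EReal.coe_le_coe_iff.2 (le_max_left _ _)
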